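/- **Theorem.** For an integer $n\ge 0$ let $\mathcal T_n$ be the monoid of all maps $\{1,\dots,n\}\to\{1,\dots,n\}$ under composition, and let $\mathcal E_n$ be the submonoid of $\mathcal T_n$ generated by all idempotents of $\mathcal T_n$. Let $E(\mathcal D_n)$ be the set of idempotents of $\mathcal T_n$ whose image has exactly $n-1$ elements if $n\ge 2$, and $E(\mathcal D_n)=\emptyset$ if $n\le 1$. For a set $U\subseteq\mathcal T_n$ write $\langle U\rangle$ for the submonoid generated by $U$. Digraphs have no loops and at most one edge $u\to v$ for each ordered pair of distinct vertices. A digraph is *complete* if for any two distinct vertices $u,v$ at least one of $u\to v$, $v\to u$ is an edge; it is *strongly connected* if for any two vertices $u,v$ there is a directed path (possibly of length $0$) from $u$ to $v$ (in particular, the digraphs with at most one vertex are strongly connected). A *double edge* is an unordered pair $\{u,v\}$ of distinct vertices such that both $u\to v$ and $v\to u$ are edges. For integers $n,k\ge 0$ let $w_{nk}$ be the number of strongly connected, complete digraphs on the vertex set $\{1,\dots,n\}$ that have exactly $k$ double edges. (So $w_{nk}=0$ if $k>\binom n2$.) 1. For all $n\ge 0$ and $0\le k\le\binom n2$, the number of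 subsets $U\subseteq E(\mathcal D_n)$ with $\langle U\rangle=\mathcal E_n$ and $|U|=\binom n2+k$ is $w_{nk}$. 2. For all $n\ge 0$, the number of subsets $U\subseteq E(\mathcal D_n)$ with $\langle U\rangle=\mathcal E_n$ is $\sum_{k=0}^{\binom n2}w_{nk}$. 3. $w_{00}=1$, and for all $n\ge 1$ and $k\ge 0$ $$w_{nk}=F_{nk}-\sum_{s=1}^{n-1}\binom ns\sum_{l=0}^{k}w_{sl}\,F_{n-s,k-l},$$ where $F_{nk}=\binom{\binom n2}{k}\,2^{\binom n2-k}$ (so $F_{nk}=0$ if $k>\binom n2$). -/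

import Mathlib

namespace IdempotentGen

/-- The full transformation monoid `T_n`: all self-maps of an `n`-element set, under composition. -/
abbrev T (n : ℕ) : Type := Function.End (Fin n)

/-- The rank of a transformation: the size of its image. -/
noncomputable def rank {n : ℕ} (f : T n) : ℕ := (Set.range f).ncard

/-- `E_n`: the submonoid of `T_n` generated by all idempotents of `T_n`. -/
def E (n : ℕ) : Submonoid (T n) := Submonoid.closure {f : T n | IsIdempotentElem f}

/-- `D_n`: the transformations of rank `n - 1` (defect `1`) if `n ≥ 2`; by convention
`D_0 = D_1 = ∅`. -/
def D (n : ℕ) : Set (T n) := {f | 2 ≤ n ∧ rank f = n - 1}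

/-- `E(D_n)`: the defect-`1` idempotents of `T_n`. -/
def ED (n : ℕ) : Set (T n) := {f | f ∈ D n ∧ IsIdempotentElem f}

/-- A digraph without loops. -/
def Loopless {V : Type*} (G : Digraph V) : Prop := ∀ v, ¬ G.Adj v v

/-- A digraph is complete if its underlying undirected graph (forget the directions, merge double
edges) is the complete graph. -/
def Complete {V : Type*} (G : Digraph V) : Prop := ∀ u v, u ≠ v → G.Adj u v ∨ G.Adj v u

/-- Any vertex can be reached from any other by a directed path.  The path of length zero joins a
vertex to itself, so a graph with one vertex, and the empty graph, are strongly connected. -/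
def StronglyConnected {V : Type*} (G : Digraph V) : Prop :=
  ∀ u v, Relation.ReflTransGen G.Adj u v

/-- The double edges of a digraph: the unordered pairs `{u, v}`, `u ≠ v`, with both `u → v` and
`v → u`. -/
def doubleEdges {V : Type*} (G : Digraph V) : Set (Sym2 V) :=
  {e | ∃ u v, u ≠ v ∧ e = s(u, v) ∧ G.Adj u v ∧ G.Adj v u}

/-- `w_{nk}`: the number of strongly connected, complete (loopless) digraphs on an `n`-element
vertex set with exactly `k` double edges. -/
noncomputable def w (n k : ℕ) : ℕ :=
  {G : Digraph (Fin n) | Loopless G ∧ Complete G ∧ StronglyConnected G ∧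
    (doubleEdges G).ncard = k}.ncard

/-- `F_{nk} = (n(n-1)/2 choose k) * 2 ^ (n(n-1)/2 - k)`; this vanishes for `k > n(n-1)/2`, because
the binomial coefficient does. -/
def F (n k : ℕ) : ℕ := (n.choose 2).choose k * 2 ^ (n.choose 2 - k)

end IdempotentGen

namespace IdempotentGen

/-! A defect-one idempotent sends one point i to another point j and fixes the rest, so a set U of
them is the edge set of a loopless digraph, with an edge i → j for each. U generates `E n` exactly
when this digraph is complete and strongly connected (`closure_eq_E_iff`). Necessity: the first
factor of a product collapses an edge, and a product moves points along paths. Sufficiency: every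
idempotent is a product of defect-one idempotents, and those absent from U are obtained along
directed paths, using completeness to close three-cycles (`merge_swap_eq`). A complete digraph has
one edge per pair plus one for each double edge, so |U| records the number of double edges.

For the recurrence, the vertices of a nonempty complete digraph that reach everything form a
nonempty strongly connected set S, and every edge between S and its complement leaves S. The digraph
is therefore determined by S, a strongly connected complete digraph on S and an arbitrary complete
digraph off S, with double edge counts adding. Summing over S expresses `F n k` through the `w s l`,
and the term |S| = n is `w n k`. -/

/-- The transformation that sends `i` to `j` and fixes every other point. -/
def merge {n : ℕ} (i j : Fin n) : T n := Function.update id i j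

/-! ### Defect-one idempotents and the generation criterion -/

section Merge
variable {n : ℕ}

lemma merge_apply (i j x : Fin n) : merge i j x = if x = i then j else x := by
  simp [merge, Function.update_apply]

@[simp] lemma merge_self (i j : Fin n) : merge i j i = j := by simp [merge]

lemma merge_of_ne {i x : Fin n} (j : Fin n) (h : x ≠ i) : merge i j x = x := by
  simp [merge_apply, h]

lemma mul_apply (f g : T n) (x : Fin n) : (f * g) x = f (g x) := rfl

lemma isIdempotentElem_iff {f : T n} : IsIdempotentElem f ↔ ∀ x, f (f x) = f x :=
  ⟨fun h x => congrFun h x, fun h => funext h⟩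

lemma isIdempotentElem_merge {i j : Fin n} : IsIdempotentElem (merge i j) := by
  rw [isIdempotentElem_iff]
  intro x
  simp only [merge_apply]
  split_ifs <;> simp_all

lemma merge_inj {i j k l : Fin n} (hij : i ≠ j) (hkl : k ≠ l) (h : merge i j = merge k l) :
    i = k ∧ j = l := by
  have hik : i = k := by
    by_contra hne
    have := congrFun h i
    rw [merge_self, merge_of_ne l hne] at this
    exact hij this.symm
  subst hik
  exact ⟨rfl, by simpa using congrFun h i⟩

lemma range_merge {i j : Fin n} (hij : i ≠ j) : Set.range (merge i j) = {i}ᶜ := by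
  ext x
  constructor
  · rintro ⟨y, rfl⟩
    by_cases h : y = i
    · rw [h, merge_self]
      exact hij.symm
    · rwa [merge_of_ne _ h]
  · exact fun h => ⟨x, merge_of_ne _ h⟩

lemma merge_mem_ED {i j : Fin n} (hij : i ≠ j) : merge i j ∈ ED n := by
  refine ⟨⟨?_, ?_⟩, isIdempotentElem_merge⟩
  · have := i.2
    have := j.2
    have : (i : ℕ) ≠ j := fun h => hij (Fin.ext h)
    omega
  · rw [rank, range_merge hij, Set.ncard_compl]
    simp

/-- An idempotent fixes its image pointwise, and here the image misses a single point i, so only the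
value at i is free. -/
lemma mem_ED_iff {f : T n} : f ∈ ED n ↔ ∃ i j, i ≠ j ∧ f = merge i j := by
  constructor
  · rintro ⟨⟨hn, hr⟩, hf⟩
    rw [isIdempotentElem_iff] at hf
    have hc : (Set.range f)ᶜ.ncard = 1 := by
      have := Set.ncard_add_ncard_compl (Set.range f)
      simp only [Nat.card_eq_fintype_card, Fintype.card_fin] at this
      rw [rank] at hr
      omega
    obtain ⟨i, hi⟩ := Set.ncard_eq_one.1 hc
    have hmem : ∀ x, x ∉ Set.range f ↔ x = i := fun x => by
      rw [← Set.mem_compl_iff, hi, Set.mem_singleton_iff]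
    refine ⟨i, f i, fun h => (hmem i).2 rfl ⟨i, h.symm⟩, funext fun x => ?_⟩
    by_cases hx : x = i
    · rw [hx, merge_self]
    · rw [merge_of_ne _ hx]
      obtain ⟨y, rfl⟩ := not_not.1 (mt (hmem x).1 hx)
      exact hf y
  · rintro ⟨i, j, hij, rfl⟩
    exact merge_mem_ED hij

/-- A submonoid containing all `merge i j` contains every idempotent. -/
lemma E_le_of_merge_mem {M : Submonoid (T n)} (hM : ∀ i j, i ≠ j → merge i j ∈ M) : E n ≤ M := by
  refine Submonoid.closure_le.2 fun f hf => ?_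
  induction hk : {x | f x ≠ x}.ncard using Nat.strong_induction_on
    generalizing f with
  | _ k ih =>
    have hf' : ∀ x, f (f x) = f x := isIdempotentElem_iff.1 hf
    by_cases hid : ∀ x, f x = x
    · have : f = 1 := funext hid
      exact this ▸ M.one_mem
    push Not at hid
    obtain ⟨x, hx⟩ := hid
    have hne : ∀ y, f y ≠ x := fun y h => hx (by rw [← h, hf'])
    -- Undo `f` at one moved point x. As x is not in the image of `f`, the result is still
    -- idempotent, and it moves one point fewer.
    let g : T n := Function.update f x x
    have hgx : g x = x := Function.update_self ..
    have hgy : ∀ y, y ≠ x → g y = f y := fun y hy => Function.update_of_ne hy ..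
    have hfg : f = g * merge x (f x) := funext fun y => by
      rw [mul_apply]
      by_cases hy : y = x
      · rw [hy, merge_self, hgy _ hx, hf']
      · rw [merge_of_ne _ hy, hgy _ hy]
    rw [hfg]
    refine M.mul_mem (ih _ ?_ (f := g) ?_ rfl) (hM _ _ hx.symm)
    · rw [← hk]
      refine Set.ncard_lt_ncard (Set.ssubset_iff_of_subset ?_ |>.2 ⟨x, hx, not_not.2 hgx⟩)
      intro y (hy : g y ≠ y)
      have hyx : y ≠ x := fun h => hy (by rw [h, hgx])
      rwa [hgy y hyx] at hy
    · refine isIdempotentElem_iff.2 fun y => ?_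
      by_cases hy : y = x
      · rw [hy, hgx, hgx]
      · rw [hgy y hy, hgy _ (hne y), hf']

/-- Rotating the points of a three-cycle reverses one of its edges. -/
lemma merge_swap_eq {i j v : Fin n} (hij : i ≠ j) (hjv : j ≠ v) (hvi : v ≠ i) :
    merge j i = (merge j v * merge v i * merge i j) ^ 2 := by
  -- The product, read from right to left, swaps i and v and sends j to v; squaring undoes the swap
  -- and leaves j ↦ i.
  funext x
  simp only [sq, mul_apply, merge_apply]
  grind

/-- The digraph on `Fin n` with an edge `i → j` for every `merge i j` in `U`. -/
def graph (U : Set (T n)) : Digraph (Fin n) := ⟨fun i j => i ≠ j ∧ merge i j ∈ U⟩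

/-- If j → i is not itself an edge, completeness supplies i → j, which closes a three-cycle through
v, and `merge_swap_eq` applies. This is the inductive step along a directed path. -/
lemma graph_closure_trans {U : Set (T n)} (hc : Complete (graph U)) {j v i : Fin n}
    (hij : i ≠ j) (hjv : j ≠ v) (hvi : v ≠ i) (h₁ : merge j v ∈ Submonoid.closure U)
    (h₂ : merge v i ∈ Submonoid.closure U) : merge j i ∈ Submonoid.closure U := by
  rcases hc j i hij.symm with h | h
  · exact Submonoid.subset_closure h.2
  · rw [merge_swap_eq hij hjv hvi]
    exact pow_mem (mul_mem (mul_mem h₁ h₂) (Submonoid.subset_closure h.2)) 2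

lemma merge_mem_closure {U : Set (T n)} (hc : Complete (graph U))
    (hs : StronglyConnected (graph U)) {i j : Fin n} (hij : i ≠ j) :
    merge i j ∈ Submonoid.closure U := by
  have key : ∀ i j, Relation.ReflTransGen (graph U).Adj i j → i ≠ j →
      merge i j ∈ Submonoid.closure U := by
    intro i j h
    induction h with
    | refl => exact fun h => absurd rfl h
    | @tail v j _ hvj ih =>
      intro hij
      have hv := Submonoid.subset_closure hvj.2
      by_cases hiv : i = v
      · rwa [hiv]
      · exact graph_closure_trans hc hij.symm hiv hvj.1 (ih hiv) hv
  exact key i j (hs i j) hij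

/-- The factor of a nonempty product that acts first identifies the ends of an edge, hence so does
the whole product. As `merge i j` identifies only i with j, that edge joins i and j. -/
lemma complete_of_closure_eq {U : Set (T n)} (hU : U ⊆ ED n) (h : Submonoid.closure U = E n) :
    Complete (graph U) := by
  have key : ∀ f ∈ Submonoid.closure U, f = 1 ∨ ∃ a b, (graph U).Adj a b ∧ f a = f b := by
    intro f hf
    induction hf using Submonoid.closure_induction_right with
    | one => exact Or.inl rfl
    | mul_right x hx y hy _ =>
      obtain ⟨a, b, hab, rfl⟩ := mem_ED_iff.1 (hU hy)
      refine Or.inr ⟨a, b, ⟨hab, hy⟩, ?_⟩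
      rw [mul_apply, mul_apply, merge_self, merge_of_ne _ hab.symm]
  intro i j hij
  rcases key (merge i j) (h ▸ Submonoid.subset_closure isIdempotentElem_merge) with
    h1 | ⟨a, b, hab, he⟩
  · have := congrFun h1 i
    rw [merge_self] at this
    exact absurd this.symm hij
  · have hne := hab.1
    rw [merge_apply, merge_apply] at he
    by_cases hai : a = i
    · rw [if_pos hai, if_neg fun hb => hne (hai.trans hb.symm)] at he
      exact Or.inl (hai ▸ he ▸ hab)
    · rw [if_neg hai] at he
      by_cases hbi : b = i
      · rw [if_pos hbi] at he
        exact Or.inr (hbi ▸ he ▸ hab)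
      · rw [if_neg hbi] at he
        exact absurd he hne

/-- A generator either fixes a point or moves it along an edge, so each element of the closure moves
points along directed paths. -/
lemma stronglyConnected_of_closure_eq {U : Set (T n)} (hU : U ⊆ ED n)
    (h : Submonoid.closure U = E n) : StronglyConnected (graph U) := by
  have key : ∀ f ∈ Submonoid.closure U, ∀ x, Relation.ReflTransGen (graph U).Adj x (f x) := by
    intro f hf
    induction hf using Submonoid.closure_induction with
    | mem f hf =>
      obtain ⟨a, b, hab, rfl⟩ := mem_ED_iff.1 (hU hf)
      intro x
      by_cases hx : x = a
      · rw [hx, merge_self]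
        exact .single ⟨hab, hf⟩
      · rw [merge_of_ne _ hx]
    | one => exact fun x => .refl
    | mul f g _ _ hf hg => exact fun x => (hg x).trans (hf (g x))
  intro i j
  by_cases hij : i = j
  · rw [hij]
  · have := key (merge i j) (h ▸ Submonoid.subset_closure isIdempotentElem_merge) i
    rwa [merge_self] at this

theorem closure_eq_E_iff {U : Set (T n)} (hU : U ⊆ ED n) :
    Submonoid.closure U = E n ↔ Complete (graph U) ∧ StronglyConnected (graph U) := by
  refine ⟨fun h => ⟨complete_of_closure_eq hU h, stronglyConnected_of_closure_eq hU h⟩,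
    fun h => le_antisymm ?_ ?_⟩
  · exact Submonoid.closure_mono fun f hf => (hU hf).2
  · exact E_le_of_merge_mem fun i j hij => merge_mem_closure h.1 h.2 hij

end Merge

/-! ### Counting edges of complete digraphs -/

section Count
variable {V : Type*}

/-- The double edges of `G` form the edge set of a simple graph. -/
def doubleGraph (G : Digraph V) : SimpleGraph V where
  Adj u v := u ≠ v ∧ G.Adj u v ∧ G.Adj v u
  symm := ⟨fun _ _ h => ⟨h.1.symm, h.2.2, h.2.1⟩⟩
  loopless := ⟨fun _ h => h.1 rfl⟩

lemma mem_doubleEdges {G : Digraph V} {u v : V} :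
    s(u, v) ∈ doubleEdges G ↔ u ≠ v ∧ G.Adj u v ∧ G.Adj v u := by
  constructor
  · rintro ⟨a, b, hab, he, h₁, h₂⟩
    rcases Sym2.eq_iff.1 he with ⟨rfl, rfl⟩ | ⟨rfl, rfl⟩
    · exact ⟨hab, h₁, h₂⟩
    · exact ⟨hab.symm, h₂, h₁⟩
  · exact fun ⟨h, h₁, h₂⟩ => ⟨u, v, h, rfl, h₁, h₂⟩

lemma edgeSet_doubleGraph (G : Digraph V) : (doubleGraph G).edgeSet = doubleEdges G := by
  ext e
  induction e with
  | _ u v => rw [mem_doubleEdges]; rfl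

variable [Fintype V]

lemma ncard_doubleEdges_le (G : Digraph V) :
    (doubleEdges G).ncard ≤ (Fintype.card V).choose 2 := by
  classical
  rw [← edgeSet_doubleGraph, Set.ncard_eq_toFinset_card', ← SimpleGraph.edgeFinset]
  exact SimpleGraph.card_edgeFinset_le_card_choose_two

/-- A complete digraph has one edge for each pair of vertices, and one more for each double
edge. -/
lemma ncard_edges {G : Digraph V} (hl : Loopless G) (hc : Complete G) :
    {p : V × V | G.Adj p.1 p.2}.ncard = (Fintype.card V).choose 2 + (doubleEdges G).ncard := by
  classical
  set A : Finset (V × V) := Finset.univ.filter fun p => G.Adj p.1 p.2 with hA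
  set B : Finset (V × V) := A.map (Equiv.prodComm V V).toEmbedding with hB
  have hmB : ∀ p, p ∈ B ↔ G.Adj p.2 p.1 := by
    rintro ⟨u, v⟩
    simp [hB, hA]
  have hu : A ∪ B = (Finset.univ : Finset V).offDiag := by
    ext ⟨u, v⟩
    simp only [Finset.mem_union, hmB, hA, Finset.mem_filter, Finset.mem_univ, true_and,
      Finset.mem_offDiag]
    refine ⟨?_, hc u v⟩
    rintro (h | h) rfl <;> exact hl _ h
  have hi : (A ∩ B).card = 2 * (doubleEdges G).ncard := by
    rw [← edgeSet_doubleGraph, Set.ncard_eq_toFinset_card', ← SimpleGraph.edgeFinset,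
      SimpleGraph.two_mul_card_edgeFinset]
    congr 1
    ext ⟨u, v⟩
    rw [Finset.mem_inter, hmB, hA, Finset.mem_filter_univ, Finset.mem_filter_univ]
    change G.Adj u v ∧ G.Adj v u ↔ u ≠ v ∧ G.Adj u v ∧ G.Adj v u
    refine ⟨fun h => ⟨?_, h⟩, fun h => h.2⟩
    rintro rfl
    exact hl _ h.1
  have hs : {p : V × V | G.Adj p.1 p.2}.ncard = A.card := by
    rw [Set.ncard_eq_toFinset_card', hA]
    congr 1
    ext
    simp
  -- Inclusion–exclusion for the edges and the reversed edges: their union is all ordered pairs of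
  -- distinct vertices, and their intersection counts each double edge twice. Parity of n(n-1) makes
  -- the halving exact.
  have := Finset.card_union_add_card_inter A B
  rw [hu, hi, hB, Finset.card_map, Finset.offDiag_card, Finset.card_univ] at this
  have h2 := Nat.choose_two_right (Fintype.card V)
  have h3 := Nat.even_mul_pred_self (Fintype.card V)
  rw [Nat.mul_sub_one] at h2 h3
  obtain ⟨m, hm⟩ := h3
  omega

end Count

/-! ### Generating sets correspond to digraphs -/

section Generating
variable {n : ℕ}

lemma loopless_graph (U : Set (T n)) : Loopless (graph U) := fun _ h => h.1 rfl

lemma ncard_edges_graph {U : Set (T n)} (hU : U ⊆ ED n) :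
    {p : Fin n × Fin n | (graph U).Adj p.1 p.2}.ncard = U.ncard := by
  rw [← Set.InjOn.ncard_image (f := fun p : Fin n × Fin n => merge p.1 p.2)]
  · congr 1
    ext f
    constructor
    · rintro ⟨p, hp, rfl⟩
      exact hp.2
    · intro hf
      obtain ⟨i, j, hij, rfl⟩ := mem_ED_iff.1 (hU hf)
      exact ⟨(i, j), ⟨hij, hf⟩, rfl⟩
  · intro p hp q hq h
    exact Prod.ext_iff.2 (merge_inj hp.1 hq.1 h)

lemma injOn_graph : Set.InjOn (graph (n := n)) {U | U ⊆ ED n} := by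
  have key : ∀ U U' : Set (T n), U ⊆ ED n → graph U = graph U' → U ⊆ U' := by
    intro U U' hU h f hf
    obtain ⟨i, j, hij, rfl⟩ := mem_ED_iff.1 (hU hf)
    have : (graph U).Adj i j := ⟨hij, hf⟩
    rw [h] at this
    exact this.2
  exact fun U hU U' hU' h => (key U U' hU h).antisymm (key U' U hU' h.symm)

lemma exists_graph_eq {G : Digraph (Fin n)} (hl : Loopless G) :
    ∃ U ⊆ ED n, graph U = G := by
  refine ⟨{f | ∃ i j, G.Adj i j ∧ f = merge i j}, ?_, ?_⟩
  · rintro f ⟨i, j, h, rfl⟩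
    exact merge_mem_ED fun hij => hl i (hij ▸ h)
  · ext i j
    constructor
    · rintro ⟨hij, a, b, h, he⟩
      have hab : a ≠ b := by
        rintro rfl
        exact hl _ h
      obtain ⟨rfl, rfl⟩ := merge_inj hij hab he
      exact h
    · exact fun h => ⟨fun hij => hl i (hij ▸ h), i, j, h, rfl⟩

lemma ncard_generating_eq_w (n k : ℕ) :
    {U : Set (T n) | U ⊆ ED n ∧ Submonoid.closure U = E n ∧
      U.ncard = n.choose 2 + k}.ncard = w n k := by
  rw [w, ← (injOn_graph.mono fun U hU => hU.1).ncard_image]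
  congr 1
  have key : ∀ U : Set (T n), U ⊆ ED n → (Submonoid.closure U = E n ∧ U.ncard = n.choose 2 + k ↔
      Complete (graph U) ∧ StronglyConnected (graph U) ∧ (doubleEdges (graph U)).ncard = k) := by
    intro U hU
    rw [closure_eq_E_iff hU, and_assoc]
    refine and_congr_right fun hc => and_congr_right fun _ => ?_
    rw [← ncard_edges_graph hU, ncard_edges (loopless_graph U) hc, Fintype.card_fin]
    omega
  ext G
  constructor
  · rintro ⟨U, ⟨hU, h⟩, rfl⟩
    exact ⟨loopless_graph U, (key U hU).1 h⟩
  · rintro ⟨hl, h⟩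
    obtain ⟨U, hU, rfl⟩ := exists_graph_eq hl
    exact ⟨U, ⟨hU, (key U hU).2 h⟩, rfl⟩

lemma ncard_generating_eq_sum (n : ℕ) :
    {U : Set (T n) | U ⊆ ED n ∧ Submonoid.closure U = E n}.ncard
      = ∑ k ∈ Finset.range (n.choose 2 + 1), w n k := by
  classical
  have : Finite (T n) := inferInstanceAs (Finite (Fin n → Fin n))
  simp only [← ncard_generating_eq_w, fun s : Set (Set (T n)) =>
    Set.ncard_eq_toFinset_card s s.toFinite]
  -- The truncated subtraction is harmless: a generating set has at least `n.choose 2` elements, the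
  -- excess being its number of double edges.
  rw [Finset.card_eq_sum_card_fiberwise (f := fun U => U.ncard - n.choose 2)
    (t := Finset.range (n.choose 2 + 1))]
  · refine Finset.sum_congr rfl fun k _ => congrArg _ ?_
    ext U
    simp only [Finset.mem_filter, Set.Finite.mem_toFinset, Set.mem_ofPred_eq, and_assoc]
    refine and_congr_right fun hU => and_congr_right fun h => ?_
    have := ncard_edges (loopless_graph U) (complete_of_closure_eq hU h)
    rw [ncard_edges_graph hU, Fintype.card_fin] at this
    omega
  · intro U hU
    simp only [Set.Finite.coe_toFinset, Set.mem_ofPred_eq] at hU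
    have := ncard_edges (loopless_graph U) (complete_of_closure_eq hU.1 hU.2)
    rw [ncard_edges_graph hU.1, Fintype.card_fin] at this
    have h2 := ncard_doubleEdges_le (graph U)
    rw [Fintype.card_fin] at h2
    simp only [Finset.coe_range, Set.mem_Iio]
    omega

end Generating

/-! ### Splitting off the source component -/

section Decomposition
variable {V : Type*}

/-- The vertices of `G` from which every vertex can be reached. -/
def sources (G : Digraph V) : Set V := {r | ∀ v, Relation.ReflTransGen G.Adj r v}

/-- The subdigraph of `G` induced by the vertices satisfying `p`. -/
def restrict (p : V → Prop) (G : Digraph V) : Digraph {x // p x} := ⟨fun a b => G.Adj a b⟩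

/-- The disjoint union of digraphs on `S` and on its complement, together with all edges from `S`
to its complement. -/
def join {S : Set V} (G₁ : Digraph {x // x ∈ S}) (G₂ : Digraph {x // x ∉ S}) : Digraph V :=
  ⟨fun u v => (∃ hu hv, G₁.Adj ⟨u, hu⟩ ⟨v, hv⟩) ∨ (∃ hu hv, G₂.Adj ⟨u, hu⟩ ⟨v, hv⟩) ∨
    (u ∈ S ∧ v ∉ S)⟩

lemma Loopless.restrict {G : Digraph V} (h : Loopless G) (p : V → Prop) :
    Loopless (restrict p G) := fun v => h v

lemma Complete.restrict {G : Digraph V} (h : Complete G) (p : V → Prop) :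
    Complete (restrict p G) := fun u v huv => h u v fun he => huv (Subtype.ext he)

lemma mem_sources_of_adj {G : Digraph V} {u v : V} (h : G.Adj u v) (hv : v ∈ sources G) :
    u ∈ sources G := fun x => .head h (hv x)

/-- A path that ends in a source consists of sources, because every predecessor of a source is one;
so it survives the restriction. -/
lemma stronglyConnected_restrict_sources (G : Digraph V) :
    StronglyConnected (restrict (· ∈ sources G) G) := by
  have key : ∀ u v, Relation.ReflTransGen G.Adj u v → ∀ hv : v ∈ sources G,
      ∃ hu : u ∈ sources G,
        Relation.ReflTransGen (restrict (· ∈ sources G) G).Adj ⟨u, hu⟩ ⟨v, hv⟩ := by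
    intro u v h hv
    induction h using Relation.ReflTransGen.head_induction_on with
    | refl => exact ⟨hv, .refl⟩
    | @head a c hac _ ih =>
      obtain ⟨hc, ih⟩ := ih
      have ha := mem_sources_of_adj hac hc
      have h : (restrict (· ∈ sources G) G).Adj ⟨a, ha⟩ ⟨c, hc⟩ := hac
      exact ⟨ha, .head h ih⟩
  rintro ⟨u, hu⟩ ⟨v, hv⟩
  exact (key u v (hu v) hv).2

/-- Take r reaching the most vertices. If r missed u, completeness would give an edge u → r, and u
would reach strictly more. -/
lemma sources_nonempty [Finite V] [Nonempty V] {G : Digraph V} (hc : Complete G) :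
    (sources G).Nonempty := by
  obtain ⟨r, hr⟩ := Finite.exists_max fun r => {v | Relation.ReflTransGen G.Adj r v}.ncard
  refine ⟨r, fun u => by_contra fun hu => ?_⟩
  have hru : r ≠ u := fun h => hu (h ▸ .refl)
  have hur : G.Adj u r := (hc r u hru).resolve_left fun h => hu (.single h)
  refine (hr u).not_gt (Set.ncard_lt_ncard ?_)
  exact (Set.ssubset_iff_of_subset fun v hv => .head hur hv).2 ⟨u, .refl, hu⟩

section Join
variable {S : Set V} {G₁ : Digraph {x // x ∈ S}} {G₂ : Digraph {x // x ∉ S}}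

lemma join_adj_mem {u v : V} (hu : u ∈ S) (hv : v ∈ S) :
    (join G₁ G₂).Adj u v ↔ G₁.Adj ⟨u, hu⟩ ⟨v, hv⟩ := by
  simp [join, hu, hv]

lemma join_adj_not_mem {u v : V} (hu : u ∉ S) (hv : v ∉ S) :
    (join G₁ G₂).Adj u v ↔ G₂.Adj ⟨u, hu⟩ ⟨v, hv⟩ := by
  simp [join, hu, hv]

lemma join_adj_of_mem_of_not_mem {u v : V} (hu : u ∈ S) (hv : v ∉ S) :
    (join G₁ G₂).Adj u v := Or.inr (Or.inr ⟨hu, hv⟩)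

lemma not_join_adj {u v : V} (hu : u ∉ S) (hv : v ∈ S) : ¬ (join G₁ G₂).Adj u v := by
  simp [join, hu, hv]

lemma restrict_join_mem : restrict (· ∈ S) (join G₁ G₂) = G₁ := by
  ext u v
  exact join_adj_mem u.2 v.2

lemma restrict_join_not_mem : restrict (· ∉ S) (join G₁ G₂) = G₂ := by
  ext u v
  exact join_adj_not_mem u.2 v.2

lemma loopless_join (h₁ : Loopless G₁) (h₂ : Loopless G₂) : Loopless (join G₁ G₂) := by
  intro v
  by_cases hv : v ∈ S
  · rw [join_adj_mem hv hv]
    exact h₁ _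
  · rw [join_adj_not_mem hv hv]
    exact h₂ _

lemma complete_join (h₁ : Complete G₁) (h₂ : Complete G₂) : Complete (join G₁ G₂) := by
  intro u v huv
  by_cases hu : u ∈ S <;> by_cases hv : v ∈ S
  · rw [join_adj_mem hu hv, join_adj_mem hv hu]
    exact h₁ _ _ (by simpa using huv)
  · exact Or.inl (join_adj_of_mem_of_not_mem hu hv)
  · exact Or.inr (join_adj_of_mem_of_not_mem hv hu)
  · rw [join_adj_not_mem hu hv, join_adj_not_mem hv hu]
    exact h₂ _ _ (by simpa using huv)

/-- No edge enters S, so only members of S can reach a point of S; nonemptiness of S provides such a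
point. -/
lemma sources_join (hS : S.Nonempty) (h₁ : StronglyConnected G₁) :
    sources (join G₁ G₂) = S := by
  have hreach : ∀ u ∈ S, ∀ v ∈ S, Relation.ReflTransGen (join G₁ G₂).Adj u v :=
    fun u hu v hv => (h₁ ⟨u, hu⟩ ⟨v, hv⟩).lift Subtype.val fun a b hab =>
      (join_adj_mem a.2 b.2).2 hab
  ext r
  constructor
  · intro hr
    obtain ⟨s, hs⟩ := hS
    refine (hr s).head_induction_on (motive := fun a _ => a ∈ S) hs ?_
    exact fun h _ hc => by_contra fun ha => not_join_adj ha hc h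
  · intro hr v
    by_cases hv : v ∈ S
    · exact hreach r hr v hv
    · exact .single (join_adj_of_mem_of_not_mem hr hv)

/-- Edges between S and its complement go one way only, so no double edge crosses. -/
lemma ncard_doubleEdges_join [Finite V] :
    (doubleEdges (join G₁ G₂)).ncard = (doubleEdges G₁).ncard + (doubleEdges G₂).ncard := by
  rw [← Set.ncard_image_of_injective (doubleEdges G₁) (Sym2.map.injective Subtype.val_injective),
    ← Set.ncard_image_of_injective (doubleEdges G₂) (Sym2.map.injective Subtype.val_injective),
    ← Set.ncard_union_eq]
  · congr 1
    ext e
    constructor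
    · rintro ⟨u, v, huv, rfl, h, h'⟩
      by_cases hu : u ∈ S <;> by_cases hv : v ∈ S
      · rw [join_adj_mem hu hv] at h
        rw [join_adj_mem hv hu] at h'
        exact Or.inl ⟨s(⟨u, hu⟩, ⟨v, hv⟩), ⟨_, _, by simpa using huv, rfl, h, h'⟩, rfl⟩
      · exact absurd h' (not_join_adj hv hu)
      · exact absurd h (not_join_adj hu hv)
      · rw [join_adj_not_mem hu hv] at h
        rw [join_adj_not_mem hv hu] at h'
        exact Or.inr ⟨s(⟨u, hu⟩, ⟨v, hv⟩), ⟨_, _, by simpa using huv, rfl, h, h'⟩, rfl⟩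
    · rintro (⟨_, ⟨u, v, huv, rfl, h, h'⟩, rfl⟩ | ⟨_, ⟨u, v, huv, rfl, h, h'⟩, rfl⟩)
      · exact ⟨u, v, fun he => huv (Subtype.ext he), rfl, (join_adj_mem u.2 v.2).2 h,
          (join_adj_mem v.2 u.2).2 h'⟩
      · exact ⟨u, v, fun he => huv (Subtype.ext he), rfl, (join_adj_not_mem u.2 v.2).2 h,
          (join_adj_not_mem v.2 u.2).2 h'⟩
  · rw [Set.disjoint_left]
    rintro _ ⟨_, ⟨u, v, -, rfl, -, -⟩, rfl⟩ ⟨_, ⟨u', v', -, rfl, -, -⟩, h⟩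
    rcases Sym2.eq_iff.1 h with ⟨h, -⟩ | ⟨h, -⟩
    · exact u'.2 (h ▸ u.2)
    · exact u'.2 (h ▸ v.2)

end Join

/-- An edge into a source makes its tail a source, so completeness forces every edge from a source
to a non-source to be present and its reverse absent. -/
lemma join_restrict_sources {G : Digraph V} (hc : Complete G) {S : Set V} (hS : sources G = S) :
    join (restrict (· ∈ S) G) (restrict (· ∉ S) G) = G := by
  subst hS
  ext u v
  by_cases hu : u ∈ sources G <;> by_cases hv : v ∈ sources G
  · exact join_adj_mem hu hv
  · refine iff_of_true (join_adj_of_mem_of_not_mem hu hv) ((hc u v ?_).resolve_right fun h =>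
      hv (mem_sources_of_adj h hu))
    exact fun h => hv (h ▸ hu)
  · exact iff_of_false (not_join_adj hu hv) fun h => hu (mem_sources_of_adj h hv)
  · exact join_adj_not_mem hu hv

end Decomposition

/-! ### Enumeration and the recurrence -/

section Enumeration

/-- The number of pairs `u < v`. -/
lemma card_lt_pairs (V : Type*) [LinearOrder V] [Fintype V] :
    (Finset.univ.filter fun p : V × V => p.1 < p.2).card = (Fintype.card V).choose 2 := by
  have h := ncard_edges (G := (⟨fun u v : V => u < v⟩ : Digraph V)) (fun v => lt_irrefl v)
    (fun u v => lt_or_gt_of_ne)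
  have h0 : doubleEdges (⟨fun u v : V => u < v⟩ : Digraph V) = ∅ := by
    ext e
    simp only [Set.mem_empty_iff_false, iff_false]
    rintro ⟨u, v, -, -, h₁, h₂⟩
    exact lt_asymm h₁ h₂
  rw [h0, Set.ncard_empty, add_zero, Set.ncard_eq_toFinset_card'] at h
  rw [← h]
  congr 1
  ext p
  simp

lemma ncard_doubleEdges_eq {V : Type*} [LinearOrder V] [Fintype V] (G : Digraph V)
    {D : Finset (V × V)} (hD : ∀ u v, (u, v) ∈ D ↔ u < v ∧ G.Adj u v ∧ G.Adj v u) :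
    (doubleEdges G).ncard = D.card := by
  rw [← Set.ncard_coe_finset, ← Set.InjOn.ncard_image (s := (D : Set (V × V))) 
    (f := fun p : V × V => s(p.1, p.2))]
  · congr 1
    ext e
    constructor
    · rintro ⟨u, v, huv, rfl, h, h'⟩
      rcases lt_or_gt_of_ne huv with hlt | hlt
      · exact ⟨(u, v), (hD _ _).2 ⟨hlt, h, h'⟩, rfl⟩
      · exact ⟨(v, u), (hD _ _).2 ⟨hlt, h', h⟩, Sym2.eq_swap⟩
    · rintro ⟨⟨u, v⟩, h, rfl⟩
      have := (hD _ _).1 h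
      exact ⟨u, v, this.1.ne, rfl, this.2⟩
  · rintro ⟨u, v⟩ h ⟨u', v'⟩ h' he
    have h1 := ((hD _ _).1 h).1
    have h2 := ((hD _ _).1 h').1
    rcases Sym2.eq_iff.1 he with ⟨rfl, rfl⟩ | ⟨rfl, rfl⟩
    · rfl
    · exact absurd h1 h2.asymm

/-- The digraph on a linear order with double edges `D`, with the edges in `O` pointing upwards and
all other ones pointing downwards. -/
def orient {V : Type*} [LinearOrder V] (D O : Finset (V × V)) : Digraph V :=
  ⟨fun u v => (u < v ∧ ((u, v) ∈ D ∨ (u, v) ∈ O)) ∨ (v < u ∧ (v, u) ∉ O)⟩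

section Orient
variable {V : Type*} [LinearOrder V] {D O : Finset (V × V)} {u v : V}

lemma orient_adj_of_lt (h : u < v) : (orient D O).Adj u v ↔ (u, v) ∈ D ∨ (u, v) ∈ O := by
  simp [orient, h, h.asymm]

lemma orient_adj_of_gt (h : v < u) : (orient D O).Adj u v ↔ (v, u) ∉ O := by
  simp [orient, h, h.asymm]

lemma loopless_orient : Loopless (orient D O) := fun v => by simp [orient]

lemma complete_orient : Complete (orient D O) := by
  intro u v huv
  rcases lt_or_gt_of_ne huv with h | h
  · rw [orient_adj_of_lt h, orient_adj_of_gt h]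
    tauto
  · rw [orient_adj_of_lt h, orient_adj_of_gt h]
    tauto

end Orient

/-- The complete digraphs with `k` double edges are counted by `F`. -/
lemma ncard_complete (V : Type*) [LinearOrder V] [Fintype V] (k : ℕ) :
    {G : Digraph V | Loopless G ∧ Complete G ∧ (doubleEdges G).ncard = k}.ncard
      = F (Fintype.card V) k := by
  classical
  set P : Finset (V × V) := Finset.univ.filter fun p => p.1 < p.2 with hP
  have hmP : ∀ u v, (u, v) ∈ P ↔ u < v := fun u v => by simp [hP]
  have hcard : ((P.powersetCard k).sigma fun D => (P \ D).powerset).card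
      = F (Fintype.card V) k := by
    rw [Finset.card_sigma, Finset.sum_congr rfl (g := fun _ => 2 ^ (P.card - k)),
      Finset.sum_const, Finset.card_powersetCard, card_lt_pairs, smul_eq_mul, F]
    intro D hD
    rw [Finset.mem_powersetCard] at hD
    rw [Finset.card_powerset, Finset.card_sdiff_of_subset hD.1, hD.2]
  rw [← hcard, Set.ncard_eq_toFinset_card']
  have hdouble : ∀ D O : Finset (V × V), D ⊆ P → O ⊆ P \ D → ∀ u v, (u, v) ∈ D ↔
      u < v ∧ (orient D O).Adj u v ∧ (orient D O).Adj v u := by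
    intro D O hD hO u v
    constructor
    · intro h
      have hlt := (hmP _ _).1 (hD h)
      rw [orient_adj_of_lt hlt, orient_adj_of_gt hlt]
      exact ⟨hlt, Or.inl h, fun ho => (Finset.mem_sdiff.1 (hO ho)).2 h⟩
    · rintro ⟨hlt, h, h'⟩
      rw [orient_adj_of_lt hlt] at h
      rw [orient_adj_of_gt hlt] at h'
      exact h.resolve_right h'
  have hsingle : ∀ D O : Finset (V × V), D ⊆ P → O ⊆ P \ D → ∀ u v, (u, v) ∈ O ↔
      u < v ∧ (orient D O).Adj u v ∧ ¬ (orient D O).Adj v u := by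
    intro D O hD hO u v
    constructor
    · intro h
      have hlt := (hmP _ _).1 (Finset.mem_sdiff.1 (hO h)).1
      rw [orient_adj_of_lt hlt, orient_adj_of_gt hlt]
      exact ⟨hlt, Or.inr h, not_not.2 h⟩
    · rintro ⟨hlt, -, h'⟩
      rw [orient_adj_of_gt hlt] at h'
      exact not_not.1 h'
  -- A complete digraph corresponds to the set D of its k double pairs together with the set O of
  -- remaining pairs oriented upwards.
  refine Finset.card_bij'
    (fun G _ => ⟨P.filter fun p => G.Adj p.1 p.2 ∧ G.Adj p.2 p.1,
      P.filter fun p => G.Adj p.1 p.2 ∧ ¬ G.Adj p.2 p.1⟩)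
    (fun x _ => orient x.1 x.2) ?_ ?_ ?_ ?_
  · intro G hG
    rw [Set.mem_toFinset] at hG
    obtain ⟨hl, hc, hk⟩ := hG
    rw [Finset.mem_sigma, Finset.mem_powersetCard, Finset.mem_powerset]
    refine ⟨⟨Finset.filter_subset _ _, ?_⟩, ?_⟩
    · rw [← hk, ncard_doubleEdges_eq]
      intro u v
      simp [hP]
    · intro p hp
      rw [Finset.mem_filter] at hp
      exact Finset.mem_sdiff.2 ⟨hp.1, fun h => hp.2.2 (Finset.mem_filter.1 h).2.2⟩
  · rintro ⟨D, O⟩ h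
    rw [Finset.mem_sigma, Finset.mem_powersetCard, Finset.mem_powerset] at h
    rw [Set.mem_toFinset]
    exact ⟨loopless_orient, complete_orient,
      (ncard_doubleEdges_eq _ (hdouble D O h.1.1 h.2)).trans h.1.2⟩
  · intro G hG
    rw [Set.mem_toFinset] at hG
    obtain ⟨hl, hc, hk⟩ := hG
    ext u v
    rcases lt_trichotomy u v with h | rfl | h
    · rw [orient_adj_of_lt h]
      simp only [Finset.mem_filter, hmP, h]
      tauto
    · exact iff_of_false (loopless_orient _) (hl _)
    · rw [orient_adj_of_gt h]
      have := hc u v h.ne'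
      simp only [Finset.mem_filter, hmP, h]
      tauto
  · rintro ⟨D, O⟩ h
    rw [Finset.mem_sigma, Finset.mem_powersetCard, Finset.mem_powerset] at h
    have h1 : (P.filter fun p => (orient D O).Adj p.1 p.2 ∧ (orient D O).Adj p.2 p.1) = D := by
      ext ⟨u, v⟩
      rw [Finset.mem_filter, hmP, hdouble D O h.1.1 h.2]
    have h2 : (P.filter fun p => (orient D O).Adj p.1 p.2 ∧ ¬ (orient D O).Adj p.2 p.1) = O := by
      ext ⟨u, v⟩
      rw [Finset.mem_filter, hmP, hsingle D O h.1.1 h.2]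
    simp only [h1, h2]

/-- The pull-back of a digraph along an equivalence. -/
def pullback {V W : Type*} (e : V ≃ W) (G : Digraph W) : Digraph V := ⟨fun u v => G.Adj (e u) (e v)⟩

section Pullback
variable {V W : Type*} (e : V ≃ W) (G : Digraph W)

lemma pullback_symm_pullback : pullback e.symm (pullback e G) = G := by
  ext u v
  simp [pullback]

variable {G}

lemma Loopless.pullback (h : Loopless G) : Loopless (pullback e G) := fun v => h (e v)

lemma Complete.pullback (h : Complete G) : Complete (pullback e G) :=
  fun u v huv => h (e u) (e v) (e.injective.ne huv)

lemma StronglyConnected.pullback (h : StronglyConnected G) :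
    StronglyConnected (pullback e G) := by
  intro u v
  have := (h (e u) (e v)).lift (p := (IdempotentGen.pullback e G).Adj) e.symm fun a b hab => by
    simpa [IdempotentGen.pullback, Function.onFun] using hab
  simpa [Function.onFun] using this

variable (G)

lemma ncard_doubleEdges_pullback :
    (doubleEdges (pullback e G)).ncard = (doubleEdges G).ncard := by
  rw [← Set.ncard_image_of_injective (doubleEdges (pullback e G)) (Sym2.map.injective e.injective)]
  congr 1
  ext x
  constructor
  · rintro ⟨_, ⟨u, v, huv, rfl, h, h'⟩, rfl⟩
    exact ⟨e u, e v, e.injective.ne huv, rfl, h, h'⟩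
  · rintro ⟨u, v, huv, rfl, h, h'⟩
    refine ⟨s(e.symm u, e.symm v), ⟨_, _, e.symm.injective.ne huv, rfl, ?_, ?_⟩, ?_⟩ <;>
      simp [pullback, h, h']

end Pullback

/-- Frees the count from `Fin n`, so that it applies to the subtype of sources. -/
lemma ncard_stronglyConnected (V : Type*) [Fintype V] (k : ℕ) :
    {G : Digraph V | Loopless G ∧ Complete G ∧ StronglyConnected G ∧
      (doubleEdges G).ncard = k}.ncard = w (Fintype.card V) k := by
  let e := Fintype.equivFin V
  have hinj : Function.Injective (pullback e) := fun G G' h => by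
    rw [← pullback_symm_pullback e G, h, pullback_symm_pullback]
  rw [w, ← Set.ncard_image_of_injective _ hinj]
  congr 1
  ext G
  constructor
  · rintro ⟨hl, hc, hs, hk⟩
    refine ⟨pullback e.symm G, ⟨hl.pullback _, hc.pullback _, hs.pullback _, ?_⟩,
      pullback_symm_pullback e.symm G⟩
    rw [ncard_doubleEdges_pullback, hk]
  · rintro ⟨G, ⟨hl, hc, hs, hk⟩, rfl⟩
    exact ⟨hl.pullback _, hc.pullback _, hs.pullback _, by rw [ncard_doubleEdges_pullback, hk]⟩

/-- Complete digraphs with a prescribed set of sources. -/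
lemma ncard_complete_sources_eq {n : ℕ} (k : ℕ) {S : Finset (Fin n)} (hS : S.Nonempty) :
    {G : Digraph (Fin n) | (Loopless G ∧ Complete G ∧ (doubleEdges G).ncard = k) ∧
      sources G = S}.ncard
      = ∑ l ∈ Finset.range (k + 1), w S.card l * F (n - S.card) (k - l) := by
  classical
  let A (l : ℕ) : Set (Digraph {x // x ∈ (S : Set (Fin n))}) :=
    {G | Loopless G ∧ Complete G ∧ StronglyConnected G ∧ (doubleEdges G).ncard = l}
  let B (l : ℕ) : Set (Digraph {x // x ∉ (S : Set (Fin n))}) :=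
    {G | Loopless G ∧ Complete G ∧ (doubleEdges G).ncard = l}
  have hA : ∀ l, (A l).ncard = w S.card l := fun l => by
    rw [ncard_stronglyConnected]
    simp
  have hB : ∀ l, (B l).ncard = F (n - S.card) l := fun l => by
    rw [ncard_complete]
    simp [Fintype.card_subtype_compl]
  let N : Finset (Digraph {x // x ∈ (S : Set (Fin n))} × Digraph {x // x ∉ (S : Set (Fin n))}) :=
    (Finset.HasAntidiagonal.antidiagonal k).biUnion fun l => (A l.1 ×ˢ B l.2).toFinset
  have hN : ∀ p, p ∈ N ↔ (Loopless p.1 ∧ Complete p.1 ∧ StronglyConnected p.1) ∧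
      (Loopless p.2 ∧ Complete p.2) ∧
      (doubleEdges p.1).ncard + (doubleEdges p.2).ncard = k := by
    intro p
    simp only [N, Finset.mem_biUnion, Finset.HasAntidiagonal.mem_antidiagonal, Set.mem_toFinset, Set.mem_prod, A, B,
      Set.mem_ofPred_eq]
    constructor
    · rintro ⟨l, hl, ⟨h1, h2, h3, h4⟩, h5, h6, h7⟩
      exact ⟨⟨h1, h2, h3⟩, ⟨h5, h6⟩, by rw [h4, h7, hl]⟩
    · rintro ⟨⟨h1, h2, h3⟩, ⟨h5, h6⟩, h⟩
      exact ⟨(_, _), h, ⟨h1, h2, h3, rfl⟩, h5, h6, rfl⟩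
  have hNcard : N.card = ∑ l ∈ Finset.range (k + 1), w S.card l * F (n - S.card) (k - l) := by
    rw [Finset.card_biUnion,
      ← Finset.Nat.sum_antidiagonal_eq_sum_range_succ fun i j => w S.card i * F (n - S.card) j]
    · refine Finset.sum_congr rfl fun l _ => ?_
      rw [← Set.ncard_eq_toFinset_card', Set.ncard_prod, hA, hB]
    · intro l _ l' _ hne
      rw [Function.onFun, Finset.disjoint_left]
      intro p hp hp'
      rw [Set.mem_toFinset] at hp hp'
      exact hne (Prod.ext (hp.1.2.2.2.symm.trans hp'.1.2.2.2) (hp.2.2.2.symm.trans hp'.2.2.2))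
  rw [← hNcard, Set.ncard_eq_toFinset_card']
  refine Finset.card_bij' (fun G _ => (restrict (· ∈ (S : Set (Fin n))) G,
    restrict (· ∉ (S : Set (Fin n))) G)) (fun p _ => join p.1 p.2) ?_ ?_ ?_ ?_
  · intro G hG
    rw [Set.mem_toFinset] at hG
    obtain ⟨⟨hl, hc, hk⟩, hs⟩ := hG
    rw [hN, ← ncard_doubleEdges_join, join_restrict_sources hc hs]
    refine ⟨⟨hl.restrict _, hc.restrict _, ?_⟩, ⟨hl.restrict _, hc.restrict _⟩, hk⟩
    rw [← hs]
    exact stronglyConnected_restrict_sources G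
  · intro p hp
    obtain ⟨⟨h1, h2, h3⟩, ⟨h5, h6⟩, h⟩ := (hN p).1 hp
    rw [Set.mem_toFinset]
    exact ⟨⟨loopless_join h1 h5, complete_join h2 h6, ncard_doubleEdges_join.trans h⟩,
      sources_join hS h3⟩
  · intro G hG
    rw [Set.mem_toFinset] at hG
    exact join_restrict_sources hG.1.2.1 hG.2
  · intro p _
    exact Prod.ext restrict_join_mem restrict_join_not_mem

lemma F_eq_sum {n : ℕ} (hn : 1 ≤ n) (k : ℕ) :
    F n k = ∑ s ∈ Finset.Icc 1 n, n.choose s *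
      ∑ l ∈ Finset.range (k + 1), w s l * F (n - s) (k - l) := by
  classical
  have : Nonempty (Fin n) := ⟨⟨0, hn⟩⟩
  -- The value at 0 must be set to 0 by hand: the empty set is never the set of sources, while the
  -- sum formula at s = 0 would contribute `F n k`.
  let f (s : ℕ) : ℕ := if s = 0 then 0 else
    ∑ l ∈ Finset.range (k + 1), w s l * F (n - s) (k - l)
  have hF := ncard_complete (Fin n) k
  rw [Fintype.card_fin, Set.ncard_eq_toFinset_card', Finset.card_eq_sum_card_fiberwise
    (f := fun G => (sources G).toFinset) (t := (Finset.univ : Finset (Fin n)).powerset)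
    (fun _ _ => by simp), Finset.sum_congr rfl (g := fun S => f S.card),
    Finset.sum_powerset_apply_card f, Finset.card_univ, Fintype.card_fin,
    Finset.sum_range_succ', Finset.range_eq_Ico, Finset.sum_Ico_add' (fun s => n.choose s • f s)]
    at hF
  · rw [← hF]
    simp only [f, if_true, smul_zero, add_zero, zero_add]
    refine Finset.sum_congr (by ext; simp) fun s hs => ?_
    rw [if_neg (by simp at hs; omega), smul_eq_mul]
  · intro S _
    rcases S.eq_empty_or_nonempty with rfl | hS
    · simp only [f, Finset.card_empty, if_true, Finset.card_eq_zero]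
      rw [Finset.filter_eq_empty_iff]
      intro G hG h
      rw [Set.mem_toFinset] at hG
      rw [Set.toFinset_eq_empty] at h
      exact (sources_nonempty hG.2.1).ne_empty h
    · simp only [f, if_neg hS.card_pos.ne']
      rw [← ncard_complete_sources_eq k hS, Set.ncard_eq_toFinset_card']
      congr 1
      ext G
      simp only [Finset.mem_filter, Set.mem_toFinset, Set.mem_ofPred_eq]
      rw [← Finset.coe_inj, Set.coe_toFinset]

lemma F_zero (k : ℕ) : F 0 k = if k = 0 then 1 else 0 := by
  cases k <;> simp [F]

lemma w_zero_zero : w 0 0 = 1 := by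
  rw [w, Set.ncard_eq_one]
  refine ⟨⊥, ?_⟩
  ext G
  have : G = ⊥ := by
    ext u
    exact u.elim0
  simp only [Set.mem_ofPred_eq, Set.mem_singleton_iff, this, iff_true]
  refine ⟨fun v => v.elim0, fun v => v.elim0, fun v => v.elim0, ?_⟩
  rw [Set.ncard_eq_zero]
  ext e
  induction e with
  | _ u v => exact u.elim0

lemma w_recurrence {n : ℕ} (hn : 1 ≤ n) (k : ℕ) :
    (w n k : ℤ) = (F n k : ℤ) - ∑ s ∈ Finset.Icc 1 (n - 1), (n.choose s : ℤ) *
      ∑ l ∈ Finset.range (k + 1), (w s l : ℤ) * (F (n - s) (k - l) : ℤ) := by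
  obtain ⟨m, rfl⟩ : ∃ m, n = m + 1 := ⟨n - 1, by omega⟩
  have h := F_eq_sum hn k
  rw [Finset.sum_Icc_succ_top (by omega)] at h
  have hlast : ∑ l ∈ Finset.range (k + 1), w (m + 1) l * F (m + 1 - (m + 1)) (k - l)
      = w (m + 1) k := by
    -- For s = n nothing lies outside the sources, and `F 0 (k - l)` vanishes unless l = k.
    rw [Finset.sum_eq_single k]
    · simp [F_zero]
    · intro l hl hne
      rw [Finset.mem_range] at hl
      rw [Nat.sub_self, F_zero, if_neg (by omega), mul_zero]
    · simp
  rw [hlast, Nat.choose_self, one_mul] at h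
  rw [h, Nat.add_sub_cancel]
  push_cast
  ring

end Enumeration
end IdempotentGen

theorem theorem2p6 :
    (∀ n k : ℕ, k ≤ n.choose 2 →
      {U : Set (IdempotentGen.T n) | U ⊆ IdempotentGen.ED n ∧
        Submonoid.closure U = IdempotentGen.E n ∧ U.ncard = n.choose 2 + k}.ncard
          = IdempotentGen.w n k) ∧
    (∀ n : ℕ,
      {U : Set (IdempotentGen.T n) | U ⊆ IdempotentGen.ED n ∧
        Submonoid.closure U = IdempotentGen.E n}.ncard
          = ∑ k ∈ Finset.range (n.choose 2 + 1), IdempotentGen.w n k) ∧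
    IdempotentGen.w 0 0 = 1 ∧
    (∀ n k : ℕ, 1 ≤ n →
      (IdempotentGen.w n k : ℤ) = (IdempotentGen.F n k : ℤ) -
        ∑ s ∈ Finset.Icc 1 (n - 1), (n.choose s : ℤ) *
          ∑ l ∈ Finset.range (k + 1),
            (IdempotentGen.w s l : ℤ) * (IdempotentGen.F (n - s) (k - l) : ℤ)) :=
  ⟨fun n k _ => IdempotentGen.ncard_generating_eq_w n k, IdempotentGen.ncard_generating_eq_sum,
    IdempotentGen.w_zero_zero, fun _ k hn => IdempotentGen.w_recurrence hn k⟩
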